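/- Let $k,l$ be coprime positive integers, let $D\in\mathbb C[[u,v]]$ be a nonzero complex power series, and give $u$ weight $k$ and $v$ weight $l$. Let the weighted initial form of $D$ (the nonzero quasi-homogeneous component of $D$ of lowest weighted degree, where $u^av^b$ has degree $ak+bl$) be written as $$C\,u^{\nu_0}v^{\nu_{n+1}}\prod_{i=1}^n (v^k-t_iu^l)^{\nu_i},$$ where $C\in\mathbb C$, the $t_i\in\mathbb C\setminus\{0\}$ are pairwise distinct and the $\nu_i$ are non-negative integers. For $t\in\mathbb C$ and a positive integer $N$ put $H_t=(v^k-tu^l)^N-u^{l(N+1)}$, and let $i_0(F,G)=\dim_{\mathbb C}\mathbb C[[u,v]]/(F,G)$ denote the intersection multiplicity at the origin. Then there is $N_0$ such that for every integer $N\ge N_0$, every $t\in\mathbb C\setminus\{0\}$ with $t\ne t_i$ for $1\le i\le n$, and every $j\in\{1,\dots,n\}$, the intersection multiplicities $i_0(D,H_{t_j})$ and $i_0(D,H_t)$ are finite and $$\nu_j\,k\,l=i_0(D,H_{t_j})-i_0(D,H_t).$$ -/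

import Mathlib

noncomputable section

namespace PlaneCurve

/-- The ring `ℂ[[u, v]]` of complex power series in two variables. -/
abbrev Series : Type := MvPowerSeries (Fin 2) ℂ

/-- The variable `u`. -/
def u : Series := MvPowerSeries.X 0

/-- The variable `v`. -/
def v : Series := MvPowerSeries.X 1

/-- The weighted initial form of `D` with respect to the weight vector `w = (k, l)`, i.e. with
`u` of weight `k` and `v` of weight `l`: the quasi-homogeneous component of `D` of the smallest
weighted degree in which `D` has a nonzero component (it is `0` for `D = 0`). -/
def initialForm (k l : ℕ) (D : Series) : Series :=
  D.weightedHomogeneousComponent ![k, l] (D.weightedOrder ![k, l]).toNat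

/-- The intersection multiplicity at the origin, `i₀(F, G) = dim_ℂ ℂ[[u, v]] / (F, G)`, with
value `⊤` when this dimension is infinite. -/
def intersectionMultiplicity (F G : Series) : ℕ∞ :=
  Cardinal.toENat (Module.rank ℂ (Series ⧸ Ideal.span {F, G}))

/-- The test polynomial `H_t = (v ^ k - t u ^ l) ^ N - u ^ (l (N + 1))`. -/
def testPolynomial (k l N : ℕ) (t : ℂ) : Series :=
  (v ^ k - MvPowerSeries.C t * u ^ l) ^ N - u ^ (l * (N + 1))

end PlaneCurve

end

/-! After the base change `u ↦ u ^ (k * N)` the test curve with parameter `T` splits into `k * N`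
smooth branches `v = u ^ (l * N) * η * ρ`, where `ρ ^ k = T + ζ * u ^ (k * l)`, `ζ ^ N = 1` and `η ^
k = 1`. The base change multiplies intersection multiplicities by `k * N`
(`intersectionMultiplicity_ramify`), and the multiplicity with a union of smooth branches is the sum
of the orders of `D` along them (`intersectionMultiplicity_prod`).

Along such a branch a monomial of weighted degree `d` has order at least `N * d`. The factor `v ^ k
- t i * u ^ l` has order exactly `N * k * l`, with an extra `k * l` when `t i = T`. For `N` larger
than the total extra order, the terms of `D` beyond the initial form cannot interfere
(`exists_arc_eq`). All branches thus give the same order, and dividing by `k * N` shows that `i₀(D,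
H_T)` is `N` times the weighted degree plus the extra order. The latter is `ν j * k * l` for `T = t
j` and zero for `T` distinct from all `t i`. -/

noncomputable section

namespace PlaneCurve

open MvPowerSeries

/-! ### Additivity of the intersection multiplicity -/

/-- If `f : Series → V` is a surjective linear map whose kernel is the ideal `(F, G)`, then the
intersection multiplicity of `F` and `G` is the dimension of `V`. -/
theorem intersectionMultiplicity_eq_of_surjective {V : Type} [AddCommGroup V] [Module ℂ V]
    (F G : Series) (f : Series →ₗ[ℂ] V) (hf : Function.Surjective f)
    (hker : ∀ x, f x = 0 ↔ x ∈ Ideal.span {F, G}) :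
    intersectionMultiplicity F G = Cardinal.toENat (Module.rank ℂ V) := by
  have h : f.ker = (Ideal.span {F, G} : Ideal Series).restrictScalars ℂ := by
    ext x
    simp [hker]
  have e := (Submodule.Quotient.restrictScalarsEquiv ℂ (Ideal.span {F, G} : Ideal Series)).symm ≪≫ₗ
    Submodule.quotEquivOfEq _ _ h.symm ≪≫ₗ f.quotKerEquivOfSurjective hf
  rw [intersectionMultiplicity, e.rank_eq]

/-- Multiplication by `G` gives the exact sequence `0 → S/(D, F) → S/(D, F * G) → S/(D, G) → 0`. The
hypothesis, that `G` is a non-zero-divisor modulo `D`, yields injectivity on the left. -/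
theorem intersectionMultiplicity_mul (D F G : Series) (hG : ∀ x, D ∣ G * x → D ∣ x) :
    intersectionMultiplicity D (F * G) =
      intersectionMultiplicity D F + intersectionMultiplicity D G := by
  set J : Submodule ℂ Series := (Ideal.span {D, F * G} : Ideal Series).restrictScalars ℂ
  set I : Submodule ℂ Series := (Ideal.span {D, G} : Ideal Series).restrictScalars ℂ
  have hJI : J ≤ I := by
    intro x hx
    obtain ⟨a, b, rfl⟩ := Ideal.mem_span_pair.1 hx
    exact Ideal.mem_span_pair.2 ⟨a, b * F, by ring⟩
  have hrank := Submodule.rank_quotient_add_rank (I.map J.mkQ)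
  have e1 : ((Series ⧸ J) ⧸ I.map J.mkQ) ≃ₗ[ℂ] Series ⧸ I :=
    Submodule.quotientQuotientEquivQuotient J I hJI
  let f : Series →ₗ[ℂ] I.map J.mkQ :=
    (J.mkQ ∘ₗ LinearMap.mulLeft ℂ G).codRestrict _ fun x =>
      Submodule.mem_map_of_mem (Ideal.mem_span_pair.2 ⟨0, x, by simp [mul_comm]⟩)
  have hf : Function.Surjective f := by
    rintro ⟨y, x, hx, rfl⟩
    obtain ⟨a, b, rfl⟩ := Ideal.mem_span_pair.1 hx
    refine ⟨b, Subtype.ext ?_⟩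
    change J.mkQ (G * b) = J.mkQ (a * D + b * G)
    rw [← sub_eq_zero, ← map_sub, Submodule.mkQ_apply, Submodule.Quotient.mk_eq_zero]
    exact Ideal.mem_span_pair.2 ⟨-a, 0, by ring⟩
  have hker : ∀ x, f x = 0 ↔ x ∈ Ideal.span {D, F} := by
    intro x
    have : f x = 0 ↔ G * x ∈ Ideal.span {D, F * G} := by
      rw [← Subtype.coe_inj]
      exact Submodule.Quotient.mk_eq_zero J
    rw [this, Ideal.mem_span_pair, Ideal.mem_span_pair]
    constructor
    · rintro ⟨a, b, h⟩
      obtain ⟨c, hc⟩ := hG (x - b * F) ⟨a, by linear_combination -h⟩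
      exact ⟨c, b, by linear_combination -hc⟩
    · rintro ⟨a, b, rfl⟩
      exact ⟨a * G, b, by ring⟩
  rw [intersectionMultiplicity_eq_of_surjective D F f hf hker]
  have e2 := Submodule.Quotient.restrictScalarsEquiv ℂ (Ideal.span {D, F * G} : Ideal Series)
  have e3 := Submodule.Quotient.restrictScalarsEquiv ℂ (Ideal.span {D, G} : Ideal Series)
  rw [intersectionMultiplicity, intersectionMultiplicity, ← e2.rank_eq, ← e3.rank_eq, ← e1.rank_eq,
    add_comm, ← map_add, hrank]

/-! ### Substitutions and arcs -/

/-- The embedding of power series in `u` alone. -/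
def embed : PowerSeries ℂ →ₐ[ℂ] Series :=
  PowerSeries.substAlgHom (PowerSeries.HasSubst.X (0 : Fin 2))

theorem embed_apply (p : PowerSeries ℂ) : embed p = p.subst u := by
  rw [embed, PowerSeries.coe_substAlgHom]
  rfl

theorem embed_X : embed PowerSeries.X = u := PowerSeries.substAlgHom_X _

theorem hasSubst_pair {τ : Type*} {a b : MvPowerSeries τ ℂ} (ha : constantCoeff a = 0)
    (hb : constantCoeff b = 0) : HasSubst ![a, b] :=
  hasSubst_of_constantCoeff_zero (by intro i; fin_cases i <;> simpa)

theorem constantCoeff_embed {p : PowerSeries ℂ} (hp : PowerSeries.constantCoeff p = 0) :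
    constantCoeff (embed p) = 0 := by
  rw [embed, PowerSeries.coe_substAlgHom]
  exact PowerSeries.constantCoeff_subst_eq_zero (by simp) _ hp

/-- Substitution of `a` for `u` and of `b` for `v`. -/
def evalPair {τ : Type*} (a b : MvPowerSeries τ ℂ) (ha : constantCoeff a = 0)
    (hb : constantCoeff b = 0) : Series →ₐ[ℂ] MvPowerSeries τ ℂ :=
  substAlgHom (hasSubst_pair ha hb)

section evalPair

variable {τ : Type*} {a b : MvPowerSeries τ ℂ} (ha : constantCoeff a = 0)
  (hb : constantCoeff b = 0)

@[simp] theorem evalPair_u : evalPair a b ha hb u = a := by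
  simp [evalPair, u, subst_X (hasSubst_pair ha hb)]

@[simp] theorem evalPair_v : evalPair a b ha hb v = b := by
  simp [evalPair, v, subst_X (hasSubst_pair ha hb)]

theorem evalPair_C (c : ℂ) : evalPair a b ha hb (C c) = C c := by
  exact AlgHom.commutes _ c

theorem evalPair_evalPair {x y : Series}
    (hx : constantCoeff x = 0) (hy : constantCoeff y = 0)
    (hc : constantCoeff (evalPair a b ha hb x) = 0) (hd : constantCoeff (evalPair a b ha hb y) = 0)
    (F : Series) :
    evalPair a b ha hb (evalPair x y hx hy F) =
      evalPair (evalPair a b ha hb x) (evalPair a b ha hb y) hc hd F := by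
  simp only [evalPair, substAlgHom_apply]
  rw [subst_comp_subst_apply (hasSubst_pair hx hy) (hasSubst_pair ha hb)]
  congr 1
  ext i : 1
  fin_cases i <;> rfl

theorem evalPair_congr {a' b' : MvPowerSeries τ ℂ} (h : a = a') (h' : b = b')
    (ha' : constantCoeff a' = 0) (hb' : constantCoeff b' = 0) :
    evalPair a b ha hb = evalPair a' b' ha' hb' := by
  subst h h'; rfl

theorem evalPair_embed (p : PowerSeries ℂ) :
    evalPair a b ha hb (embed p) = p.subst a := by
  simp only [evalPair, substAlgHom_apply, embed, PowerSeries.substAlgHom]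
  rw [PowerSeries.subst, subst_comp_subst_apply (PowerSeries.HasSubst.X (0 : Fin 2)).const
    (hasSubst_pair ha hb)]
  congr 1
  ext i : 1
  simp [subst_X (hasSubst_pair ha hb)]

theorem evalPair_u_v (F : Series) (h : constantCoeff u = 0) (h' : constantCoeff v = 0) :
    evalPair u v h h' F = F := by
  rw [evalPair, substAlgHom_apply]
  have : (![u, v] : Fin 2 → Series) = X := by
    ext i : 1
    fin_cases i <;> rfl
  rw [this, subst_self, id]

end evalPair

@[simp] theorem constantCoeff_u : constantCoeff u = 0 := by simp [u]
@[simp] theorem constantCoeff_v : constantCoeff v = 0 := by simp [v]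

/-- The restriction of a series to the arc `u = a(τ)`, `v = b(τ)`. -/
def arc (a b : PowerSeries ℂ) (ha : PowerSeries.constantCoeff a = 0)
    (hb : PowerSeries.constantCoeff b = 0) : Series →ₐ[ℂ] PowerSeries ℂ :=
  evalPair (τ := Unit) a b ha hb

section arc

variable {a b : PowerSeries ℂ} (ha : PowerSeries.constantCoeff a = 0)
  (hb : PowerSeries.constantCoeff b = 0)

theorem arc_u : arc a b ha hb u = a := evalPair_u _ _

theorem arc_v : arc a b ha hb v = b := evalPair_v _ _

theorem arc_C (c : ℂ) : arc a b ha hb (C c) = PowerSeries.C c := evalPair_C _ _ c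

theorem arc_embed (p : PowerSeries ℂ) : arc a b ha hb (embed p) = p.subst a := evalPair_embed _ _ p

theorem arc_evalPair {a' b' : PowerSeries ℂ} (ha' : PowerSeries.constantCoeff a' = 0)
    (hb' : PowerSeries.constantCoeff b' = 0) {x y : Series} (hx : constantCoeff x = 0)
    (hy : constantCoeff y = 0) (hxa : arc a b ha hb x = a') (hyb : arc a b ha hb y = b')
    (F : Series) : arc a b ha hb (evalPair x y hx hy F) = arc a' b' ha' hb' F := by
  subst hxa hyb
  exact evalPair_evalPair (τ := Unit) ha hb hx hy ha' hb' F

end arc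

/-! ### Smooth branches `v = p(u)` -/

/-- The restriction of a series to the branch `v = p(u)`. -/
def restrict (p : PowerSeries ℂ) (hp : PowerSeries.constantCoeff p = 0) :
    Series →ₐ[ℂ] PowerSeries ℂ :=
  arc PowerSeries.X p PowerSeries.constantCoeff_X hp

theorem restrict_embed {p : PowerSeries ℂ} (hp : PowerSeries.constantCoeff p = 0)
    (f : PowerSeries ℂ) : restrict p hp (embed f) = f :=
  (arc_embed _ _ f).trans (PowerSeries.X_subst f)

theorem restrict_u {p : PowerSeries ℂ} (hp : PowerSeries.constantCoeff p = 0) :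
    restrict p hp u = PowerSeries.X := arc_u _ _

theorem restrict_v {p : PowerSeries ℂ} (hp : PowerSeries.constantCoeff p = 0) :
    restrict p hp v = p := arc_v _ _

theorem evalPair_apply {τ : Type*} {a b : MvPowerSeries τ ℂ} (ha : constantCoeff a = 0)
    (hb : constantCoeff b = 0) (F : Series) (e : τ →₀ ℕ) :
    coeff e (evalPair a b ha hb F) =
      finsum fun d : Fin 2 →₀ ℕ => coeff d F * coeff e (a ^ d 0 * b ^ d 1) := by
  rw [evalPair, substAlgHom_apply, coeff_subst (hasSubst_pair ha hb)]
  congr 1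
  ext d
  rw [Finsupp.prod_fintype _ _ (by simp)]
  simp

theorem coeff_restrict_zero (F : Series) (n : ℕ) :
    PowerSeries.coeff n (restrict 0 (map_zero _) F) = coeff (Finsupp.single 0 n) F := by
  have h := evalPair_apply (τ := Unit) PowerSeries.constantCoeff_X (b := (0 : PowerSeries ℂ))
    (map_zero _) F (Finsupp.single () n)
  refine h.trans ?_
  have key : ∀ d : Fin 2 →₀ ℕ, d ≠ Finsupp.single 0 n →
      PowerSeries.coeff n ((PowerSeries.X : PowerSeries ℂ) ^ d 0 * 0 ^ d 1) = 0 := by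
    intro d hd
    by_cases h1 : d 1 = 0
    · rw [h1, pow_zero, mul_one, PowerSeries.coeff_X_pow, if_neg]
      rintro rfl
      apply hd
      ext i
      fin_cases i <;> simp [h1]
    · simp [h1]
  rw [finsum_eq_single _ (Finsupp.single 0 n)]
  · have : PowerSeries.coeff n ((PowerSeries.X : PowerSeries ℂ) ^ n * 0 ^ 0) = 1 := by simp
    simp only [Finsupp.single_eq_same, ne_eq, one_ne_zero, not_false_eq_true,
      Finsupp.single_eq_of_ne]
    exact (congrArg _ this).trans (mul_one _)
  · intro d hd
    exact (congrArg _ (key d hd)).trans (mul_zero _)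

theorem v_dvd_of_restrict_zero (F : Series) (h : restrict 0 (map_zero _) F = 0) : v ∣ F := by
  rw [v, X_dvd_iff]
  intro m hm
  have : m = Finsupp.single 0 (m 0) := by
    ext i
    fin_cases i <;> simp [hm]
  rw [this, ← coeff_restrict_zero, h, map_zero]

/-- The change of variables `v ↦ v + p(u)`, with inverse `v ↦ v - p(u)`, reduces this to `p = 0`. -/
theorem sub_embed_dvd {p : PowerSeries ℂ} (hp : PowerSeries.constantCoeff p = 0) (F : Series)
    (h : restrict p hp F = 0) : v - embed p ∣ F := by
  have hc := constantCoeff_embed hp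
  have h1 : constantCoeff (v + embed p) = 0 := by simp [hc]
  have h2 : constantCoeff (v - embed p) = 0 := by simp [hc]
  have e1 : restrict 0 (map_zero _) (v + embed p) = p := by
    rw [map_add, restrict_embed, restrict_v, zero_add]
  have hF : restrict 0 (map_zero _) (evalPair u (v + embed p) constantCoeff_u h1 F) = 0 := by
    exact (arc_evalPair _ _ _ hp _ h1 (restrict_u _) e1 F).trans h
  have e2 : evalPair u (v - embed p) constantCoeff_u h2 (v + embed p) = v := by
    rw [map_add, evalPair_v, evalPair_embed]
    rw [← embed_apply, sub_add_cancel]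
  have := map_dvd (evalPair u (v - embed p) constantCoeff_u h2) (v_dvd_of_restrict_zero _ hF)
  rw [evalPair_v, evalPair_evalPair] at this
  · rwa [evalPair_congr _ _ (evalPair_u _ _) e2 constantCoeff_u constantCoeff_v,
      evalPair_u_v] at this
  · simp
  · simp [e2]

theorem restrict_sub_embed {p : PowerSeries ℂ} (hp : PowerSeries.constantCoeff p = 0) :
    restrict p hp (v - embed p) = 0 := by
  rw [map_sub, restrict_embed, restrict_v, sub_self]

/-- The intersection multiplicity with a smooth branch `v = p(u)` is the order of the
restriction. -/
theorem intersectionMultiplicity_branch {p : PowerSeries ℂ}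
    (hp : PowerSeries.constantCoeff p = 0) (F : Series) (M : ℕ) (w : PowerSeries ℂ)
    (hw : PowerSeries.constantCoeff w ≠ 0) (hF : restrict p hp F = PowerSeries.X ^ M * w) :
    intersectionMultiplicity F (v - embed p) = M := by
  let f : Series →ₗ[ℂ] (Fin M → ℂ) :=
    LinearMap.pi fun i : Fin M => PowerSeries.coeff (i : ℕ) ∘ₗ (restrict p hp).toLinearMap
  rw [intersectionMultiplicity_eq_of_surjective F _ f]
  · rw [rank_fun', Fintype.card_fin, map_natCast]
  · intro y
    refine ⟨embed (PowerSeries.mk fun i => if h : i < M then y ⟨i, h⟩ else 0), ?_⟩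
    ext i
    simp [f, restrict_embed]
  · intro x
    have h1 : f x = 0 ↔ PowerSeries.X ^ M ∣ restrict p hp x := by
      rw [PowerSeries.X_pow_dvd_iff]
      constructor
      · intro h m hm
        exact congrFun h ⟨m, hm⟩
      · intro h
        ext i
        exact h i i.2
    rw [h1, Ideal.mem_span_pair]
    constructor
    · rintro ⟨g, hg⟩
      -- Since `w` is a unit, `g * w⁻¹` times the restriction of `F` recovers the restriction of
      -- `x`.
      obtain ⟨q, hq⟩ := sub_embed_dvd hp (x - embed (g * w⁻¹) * F) (by
        rw [map_sub, map_mul, restrict_embed, hF, hg, sub_eq_zero]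
        linear_combination (-PowerSeries.X ^ M * g) * PowerSeries.mul_inv_cancel w hw)
      exact ⟨embed (g * w⁻¹), q, by linear_combination -hq⟩
    · rintro ⟨a, b, rfl⟩
      rw [map_add, map_mul, map_mul, restrict_sub_embed, hF]
      exact ⟨restrict p hp a * w, by ring⟩

theorem intersectionMultiplicity_one (F : Series) : intersectionMultiplicity F 1 = 0 := by
  rw [intersectionMultiplicity_eq_of_surjective (V := Fin 0 → ℂ) F 1 0]
  · simp
  · exact fun y => ⟨0, Subsingleton.elim _ _⟩
  · intro x
    simpa using Ideal.mem_span_pair.2 ⟨0, x, by simp⟩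

/-- The intersection multiplicity with a union of smooth branches `v = p i (u)`. -/
theorem intersectionMultiplicity_prod {ι : Type*} (s : Finset ι) (F : Series)
    (p : ι → PowerSeries ℂ) (hp : ∀ i, PowerSeries.constantCoeff (p i) = 0) (M : ℕ)
    (hF : ∀ i ∈ s, ∃ w, PowerSeries.constantCoeff w ≠ 0 ∧
      restrict (p i) (hp i) F = PowerSeries.X ^ M * w) :
    intersectionMultiplicity F (∏ i ∈ s, (v - embed (p i))) = (s.card * M : ℕ) := by
  classical
  induction s using Finset.induction_on with
  | empty => simp [intersectionMultiplicity_one]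
  | insert i s hi ih =>
    obtain ⟨w, hw, h⟩ := hF i (Finset.mem_insert_self _ _)
    rw [Finset.prod_insert hi, mul_comm, intersectionMultiplicity_mul,
      intersectionMultiplicity_branch (hp i) F M w hw h,
      ih fun j hj => hF j (Finset.mem_insert_of_mem hj), Finset.card_insert_of_notMem hi]
    · push_cast; ring
    -- Non-zero-divisor condition: from `(v - p i) * x = F * y`, restriction to the branch kills
    -- `y`, because `F` does not vanish there. So `v - p i` divides `y` and can be cancelled.
    · rintro x ⟨y, hy⟩
      have h0 : restrict (p i) (hp i) y = 0 := by
        have := congrArg (restrict (p i) (hp i)) hy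
        rw [map_mul, map_mul, restrict_sub_embed, zero_mul, h, eq_comm, mul_eq_zero] at this
        refine this.resolve_left (mul_ne_zero (pow_ne_zero _ PowerSeries.X_ne_zero) ?_)
        rintro rfl
        exact hw (map_zero _)
      obtain ⟨z, rfl⟩ := sub_embed_dvd (hp i) y h0
      have hne : v - embed (p i) ≠ 0 := by
        intro h
        have key : ∀ (q : PowerSeries ℂ) (hq : PowerSeries.constantCoeff q = 0), q = p i := by
          intro q hq
          have := congrArg (restrict q hq) h
          rwa [map_sub, restrict_v, restrict_embed, map_zero, sub_eq_zero] at this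
        exact PowerSeries.X_ne_zero (R := ℂ) ((key _ PowerSeries.constantCoeff_X).trans
          (key 0 (map_zero _)).symm)
      exact ⟨z, mul_left_cancel₀ hne (by linear_combination hy)⟩

/-! ### The base change `u ↦ u ^ m` -/

/-- The exponent of the monomial `u ^ a * v ^ b`. -/
def expo (a b : ℕ) : Fin 2 →₀ ℕ := Finsupp.single 0 a + Finsupp.single 1 b

@[simp] theorem expo_zero (a b : ℕ) : expo a b 0 = a := by simp [expo]

@[simp] theorem expo_one (a b : ℕ) : expo a b 1 = b := by simp [expo]

theorem expo_eta (e : Fin 2 →₀ ℕ) : expo (e 0) (e 1) = e := by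
  ext i
  fin_cases i <;> simp

theorem eq_expo_iff (e : Fin 2 →₀ ℕ) (a b : ℕ) : e = expo a b ↔ e 0 = a ∧ e 1 = b := by
  constructor
  · rintro rfl
    simp
  · rintro ⟨rfl, rfl⟩
    exact (expo_eta e).symm

theorem coeff_u_pow_mul_v_pow (a b : ℕ) (e : Fin 2 →₀ ℕ) :
    coeff e (u ^ a * v ^ b) = if e 0 = a ∧ e 1 = b then 1 else 0 := by
  rw [u, v, X_pow_eq, X_pow_eq, monomial_mul_monomial, mul_one, coeff_monomial]
  simp only [← eq_expo_iff, expo]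

theorem coeff_u_pow_mul (i n b : ℕ) (G : Series) :
    coeff (expo n b) (u ^ i * G) = if i ≤ n then coeff (expo (n - i) b) G else 0 := by
  rw [u, X_pow_eq, coeff_monomial_mul]
  have h : Finsupp.single 0 i ≤ expo n b ↔ i ≤ n := by
    simp
  have h' : expo n b - Finsupp.single 0 i = expo (n - i) b := by
    rw [eq_expo_iff]
    simp
  simp only [h, h', one_mul]

/-- The base change `u ↦ u ^ m`. -/
def ramify (m : ℕ) (hm : m ≠ 0) : Series →ₐ[ℂ] Series :=
  evalPair (u ^ m) v (by simp [hm]) constantCoeff_v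

theorem coeff_ramify (m : ℕ) (hm : m ≠ 0) (n b : ℕ) (F : Series) :
    coeff (expo n b) (ramify m hm F) = if m ∣ n then coeff (expo (n / m) b) F else 0 := by
  rw [ramify, evalPair_apply]
  simp only [← pow_mul, coeff_u_pow_mul_v_pow, expo_zero, expo_one]
  rw [finsum_eq_single _ (expo (n / m) b)]
  · simp only [expo_zero, expo_one, and_true, mul_ite, mul_one, mul_zero]
    congr 1
    exact propext ⟨fun h => ⟨_, h⟩, fun h => (Nat.mul_div_cancel' h).symm⟩
  · intro d hd
    rw [if_neg, mul_zero]
    rintro ⟨rfl, rfl⟩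
    apply hd
    rw [Nat.mul_div_cancel_left _ (Nat.pos_of_ne_zero hm), expo_eta]

/-- The decomposition of the ramified ring `ℂ[[u, v]]` over its subring `ℂ[[u ^ m, v]]`. -/
def ramifySum (m : ℕ) (hm : m ≠ 0) : (Fin m → Series) →ₗ[ℂ] Series :=
  ∑ i : Fin m, LinearMap.mulLeft ℂ (u ^ (i : ℕ)) ∘ₗ (ramify m hm).toLinearMap ∘ₗ LinearMap.proj i

theorem ramifySum_apply (m : ℕ) (hm : m ≠ 0) (f : Fin m → Series) :
    ramifySum m hm f = ∑ i : Fin m, u ^ (i : ℕ) * ramify m hm (f i) := by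
  simp [ramifySum]

theorem coeff_ramifySum (m : ℕ) (hm : m ≠ 0) (f : Fin m → Series) (j : Fin m) (a b : ℕ) :
    coeff (expo (m * a + j) b) (ramifySum m hm f) = coeff (expo a b) (f j) := by
  rw [ramifySum_apply, map_sum, Finset.sum_eq_single j]
  · rw [coeff_u_pow_mul, if_pos (Nat.le_add_left _ _), Nat.add_sub_cancel, coeff_ramify,
      if_pos (dvd_mul_right _ _), Nat.mul_div_cancel_left _ (Nat.pos_of_ne_zero hm)]
  · intro i _ hij
    rw [coeff_u_pow_mul]
    split_ifs with h
    · rw [coeff_ramify, if_neg]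
      intro hd
      have h1 : (m * a + j : ℕ) ≡ i [MOD m] := ((Nat.modEq_iff_dvd' h).2 hd).symm
      have h2 : (j : ℕ) % m = i % m := by simpa [Nat.ModEq] using h1
      rw [Nat.mod_eq_of_lt j.2, Nat.mod_eq_of_lt i.2] at h2
      exact hij (Fin.ext h2.symm)
    · rfl
  · simp

/-- Euclidean division of the `u`-exponent by `m`: the `j`-th component collects the monomials with
remainder `j`. -/
theorem ramifySum_bijective (m : ℕ) (hm : m ≠ 0) : Function.Bijective (ramifySum m hm) := by
  constructor
  · intro f g h
    ext j e
    rw [← expo_eta e, ← coeff_ramifySum m hm, ← coeff_ramifySum m hm, h]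
  · intro G
    refine ⟨fun j e => coeff (expo (m * e 0 + j) (e 1)) G, ?_⟩
    ext e
    have hlt := Nat.mod_lt (e 0) (Nat.pos_of_ne_zero hm)
    have he : expo (m * (e 0 / m) + (⟨e 0 % m, hlt⟩ : Fin m)) (e 1) = e := by
      rw [Nat.div_add_mod, expo_eta]
    rw [← he]
    refine (coeff_ramifySum m hm _ _ _ _).trans ?_
    change coeff (expo (m * (expo _ _ 0) + _) (expo _ _ 1)) G = _
    simp

theorem ramifySum_mul (m : ℕ) (hm : m ≠ 0) (f : Fin m → Series) (F : Series) :
    ramifySum m hm (fun i => f i * F) = ramifySum m hm f * ramify m hm F := by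
  simp only [ramifySum_apply, map_mul, Finset.sum_mul, mul_assoc]

/-- Intersection multiplicities get multiplied by `m` under the base change `u ↦ u ^ m`. -/
theorem intersectionMultiplicity_ramify (m : ℕ) (hm : m ≠ 0) (F G : Series) :
    intersectionMultiplicity (ramify m hm F) (ramify m hm G) =
      m * intersectionMultiplicity F G := by
  -- The ramified ring is free of rank `m` over its subring, and the ideal of the ramified pair
  -- corresponds to `m` copies of `(F, G)`. Hence the quotient is `m` copies of the original one.
  let e := LinearEquiv.ofBijective (ramifySum m hm) (ramifySum_bijective m hm)
  let q : Series →ₗ[ℂ] Series ⧸ Ideal.span {F, G} :=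
    (Ideal.Quotient.mkₐ ℂ (Ideal.span {F, G})).toLinearMap
  let g : Series →ₗ[ℂ] (Fin m → Series ⧸ Ideal.span {F, G}) :=
    LinearMap.pi (fun i => q ∘ₗ LinearMap.proj i) ∘ₗ e.symm.toLinearMap
  have hq : ∀ x, q x = 0 ↔ x ∈ Ideal.span {F, G} := fun x => Ideal.Quotient.eq_zero_iff_mem
  have hg : ∀ f, g (ramifySum m hm f) = fun i => q (f i) := by
    intro f
    have : e.symm (ramifySum m hm f) = f := e.symm_apply_apply f
    ext i
    simp [g, this]
  rw [intersectionMultiplicity_eq_of_surjective _ _ g]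
  · rw [rank_pi, intersectionMultiplicity]
    simp
  · intro y
    choose x hx using fun i => Ideal.Quotient.mk_surjective (y i)
    exact ⟨ramifySum m hm x, (hg x).trans (funext hx)⟩
  · intro x
    obtain ⟨f, rfl⟩ := (ramifySum_bijective m hm).2 x
    rw [hg, Ideal.mem_span_pair, funext_iff]
    simp only [Pi.zero_apply, hq, Ideal.mem_span_pair]
    constructor
    · intro h
      choose a b h using h
      refine ⟨ramifySum m hm a, ramifySum m hm b, ?_⟩
      rw [← ramifySum_mul, ← ramifySum_mul, ← map_add]
      exact congrArg _ (funext h)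
    · rintro ⟨a, b, h⟩
      obtain ⟨a, rfl⟩ := (ramifySum_bijective m hm).2 a
      obtain ⟨b, rfl⟩ := (ramifySum_bijective m hm).2 b
      rw [← ramifySum_mul, ← ramifySum_mul, ← map_add] at h
      intro i
      exact ⟨a i, b i, congrFun ((ramifySum_bijective m hm).1 h) i⟩

/-- Substitute `h / T` into the binomial series of `(1 + X) ^ (1 / k)` and multiply by a `k`-th root
of `T`. -/
theorem exists_pow_eq_C_add (k : ℕ) (hk : k ≠ 0) (T : ℂ) (hT : T ≠ 0) (h : PowerSeries ℂ)
    (hh : PowerSeries.constantCoeff h = 0) :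
    ∃ ρ : PowerSeries ℂ, ρ ^ k = PowerSeries.C T + h := by
  obtain ⟨r, hr⟩ := IsAlgClosed.exists_pow_nat_eq T (Nat.pos_of_ne_zero hk)
  have hpow : ∀ (q : ℚ) (n : ℕ), PowerSeries.binomialSeries ℂ q ^ n =
      PowerSeries.binomialSeries ℂ (n * q) := by
    intro q n
    induction n with
    | zero => simp
    | succ n ih => rw [pow_succ, ih, ← PowerSeries.binomialSeries_add]; congr 1; push_cast; ring
  have hB : PowerSeries.binomialSeries ℂ ((k : ℚ)⁻¹) ^ k = 1 + PowerSeries.X := by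
    rw [hpow, mul_inv_cancel₀ (Nat.cast_ne_zero.2 hk)]
    simpa using PowerSeries.binomialSeries_nat (R := ℚ) (A := ℂ) 1
  have hs : PowerSeries.HasSubst (PowerSeries.C T⁻¹ * h) :=
    PowerSeries.HasSubst.of_constantCoeff_zero' (by simp [hh])
  refine ⟨PowerSeries.C r * PowerSeries.substAlgHom hs
    (PowerSeries.binomialSeries ℂ ((k : ℚ)⁻¹)), ?_⟩
  rw [mul_pow, ← map_pow, ← map_pow, hB, hr, map_add, map_one, PowerSeries.substAlgHom_X, mul_add,
    mul_one, ← mul_assoc, ← map_mul, mul_inv_cancel₀ hT, map_one, one_mul]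

/-! ### Weighted orders, the initial form, and the order of `D` along arcs -/

theorem weight_pair (k l : ℕ) (e : Fin 2 →₀ ℕ) :
    Finsupp.weight ![k, l] e = k * e 0 + l * e 1 := by
  rw [Finsupp.weight_apply, Finsupp.sum_fintype _ _ (by simp)]
  simp [mul_comm]

section weightedOrder

variable (k l : ℕ)

theorem le_weightedOrder_u : (k : ℕ∞) ≤ u.weightedOrder ![k, l] := by
  refine le_weightedOrder _ fun d hd => ?_
  rw [u, coeff_X, if_neg]
  rintro rfl
  simp [weight_pair] at hd

theorem le_weightedOrder_v : (l : ℕ∞) ≤ v.weightedOrder ![k, l] := by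
  refine le_weightedOrder _ fun d hd => ?_
  rw [v, coeff_X, if_neg]
  rintro rfl
  simp [weight_pair] at hd

variable {k l} in
theorem le_weightedOrder_pow_of_le {F : Series} {a : ℕ} (h : (a : ℕ∞) ≤ F.weightedOrder ![k, l])
    (n : ℕ) : ((n * a : ℕ) : ℕ∞) ≤ (F ^ n).weightedOrder ![k, l] := by
  refine le_trans ?_ (le_weightedOrder_pow _ n)
  rw [nsmul_eq_mul]
  push_cast
  gcongr

variable {k l} in
theorem le_weightedOrder_mul_of_le {F G : Series} {a b : ℕ}
    (h : (a : ℕ∞) ≤ F.weightedOrder ![k, l]) (h' : (b : ℕ∞) ≤ G.weightedOrder ![k, l]) :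
    ((a + b : ℕ) : ℕ∞) ≤ (F * G).weightedOrder ![k, l] := by
  refine le_trans ?_ (le_weightedOrder_mul _)
  push_cast
  gcongr

theorem le_weightedOrder_binomial (t : ℂ) :
    ((k * l : ℕ) : ℕ∞) ≤ (v ^ k - C t * u ^ l).weightedOrder ![k, l] := by
  rw [sub_eq_add_neg]
  refine le_trans (le_min (le_weightedOrder_pow_of_le (le_weightedOrder_v k l) k) ?_)
    (min_weightedOrder_le_add _)
  rw [weightedOrder_neg]
  have := le_weightedOrder_mul_of_le (F := C t) (a := 0) (by simp)
    (le_weightedOrder_pow_of_le (le_weightedOrder_u k l) l)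
  rwa [zero_add, mul_comm] at this

theorem le_weightedOrder_prod_form {n : ℕ} (c : ℂ) (t : Fin n → ℂ) (a b : ℕ) (ν : Fin n → ℕ) :
    ((a * k + b * l + ∑ i, ν i * (k * l) : ℕ) : ℕ∞) ≤
      (C c * u ^ a * v ^ b * ∏ i, (v ^ k - C (t i) * u ^ l) ^ ν i).weightedOrder ![k, l] := by
  refine le_weightedOrder_mul_of_le (le_weightedOrder_mul_of_le ?_
    (le_weightedOrder_pow_of_le (le_weightedOrder_v k l) b)) ?_
  · have := le_weightedOrder_mul_of_le (F := C c) (a := 0) (by simp)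
      (le_weightedOrder_pow_of_le (le_weightedOrder_u k l) a)
    rwa [zero_add] at this
  · refine le_trans ?_ (le_weightedOrder_prod _ _ _)
    push_cast
    refine Finset.sum_le_sum fun i _ => ?_
    exact_mod_cast le_weightedOrder_pow_of_le (le_weightedOrder_binomial k l (t i)) (ν i)

end weightedOrder

section initialForm

variable {k l : ℕ} {D : Series}

theorem exists_coeff_initialForm (hD : D ≠ 0) :
    ∃ e, coeff e (initialForm k l D) ≠ 0 ∧
      Finsupp.weight ![k, l] e = (D.weightedOrder ![k, l]).toNat := by
  obtain ⟨e, he, hw⟩ := exists_coeff_ne_zero_and_weightedOrder ![k, l]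
    ((ne_zero_iff_weightedOrder_finite ![k, l]).1 hD)
  have hw' : Finsupp.weight ![k, l] e = (D.weightedOrder ![k, l]).toNat := by
    rw [← hw, ENat.toNat_natCast]
  refine ⟨e, ?_, hw'⟩
  rwa [initialForm, coeff_weightedHomogeneousComponent, if_pos hw']

theorem coeff_sub_initialForm (hD : D ≠ 0) (e : Fin 2 →₀ ℕ)
    (he : Finsupp.weight ![k, l] e ≤ (D.weightedOrder ![k, l]).toNat) :
    coeff e (D - initialForm k l D) = 0 := by
  rw [map_sub, initialForm, coeff_weightedHomogeneousComponent]
  split_ifs with h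
  · simp
  · rw [sub_zero]
    apply coeff_eq_zero_of_lt_weightedOrder ![k, l]
    rw [← (ne_zero_iff_weightedOrder_finite ![k, l]).1 hD]
    exact_mod_cast lt_of_le_of_ne he h

end initialForm

/-- The arc gives `u` order `k * N` and `v` order at least `l * N`, so weighted degrees are scaled
by `N`. -/
theorem X_pow_dvd_arc {k l N d : ℕ} {ρ : PowerSeries ℂ} (h) (h') {E : Series}
    (hE : ∀ e, Finsupp.weight ![k, l] e < d → coeff e E = 0) :
    PowerSeries.X ^ (N * d) ∣
      arc (PowerSeries.X ^ (k * N)) (PowerSeries.X ^ (l * N) * ρ) h h' E := by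
  rw [PowerSeries.X_pow_dvd_iff]
  intro n hn
  refine (evalPair_apply h h' E (Finsupp.single () n)).trans ?_
  apply finsum_eq_zero_of_forall_eq_zero
  intro e
  by_cases he : Finsupp.weight ![k, l] e < d
  · rw [hE e he, zero_mul]
  · have hdvd : (PowerSeries.X : PowerSeries ℂ) ^ (N * d) ∣
        (PowerSeries.X ^ (k * N)) ^ e 0 * (PowerSeries.X ^ (l * N) * ρ) ^ e 1 := by
      have : (PowerSeries.X ^ (k * N)) ^ e 0 * (PowerSeries.X ^ (l * N) * ρ) ^ e 1 =
          PowerSeries.X ^ (N * Finsupp.weight ![k, l] e) * ρ ^ e 1 := by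
        rw [weight_pair]
        ring
      rw [this]
      exact (pow_dvd_pow _ (Nat.mul_le_mul_left _ (not_lt.1 he))).mul_right _
    have := PowerSeries.X_pow_dvd_iff.1 hdvd n hn
    exact (congrArg _ this).trans (mul_zero _)

theorem pow_sub_pow_eq_prod_nthRoots (n : ℕ) (hn : 0 < n) (x y : Series) :
    x ^ n - y ^ n = ∏ ζ ∈ Polynomial.nthRootsFinset n (1 : ℂ), (x - C ζ * y) := by
  have : IsDomain Series := NoZeroDivisors.to_isDomain _
  have hζ := Complex.isPrimitiveRoot_exp n hn.ne'
  have hinj : Function.Injective (C : ℂ →+* Series) := (C : ℂ →+* Series).injective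
  have hζ' := hζ.map_of_injective hinj
  -- The constants already supply `n` distinct roots of unity, so the power series ring has no
  -- others.
  have himage : (Polynomial.nthRootsFinset n (1 : ℂ)).map ⟨C, hinj⟩ =
      Polynomial.nthRootsFinset n (1 : Series) := by
    refine Finset.eq_of_subset_of_card_le ?_ ?_
    · intro z hz
      obtain ⟨a, ha, rfl⟩ := Finset.mem_map.1 hz
      rw [Polynomial.mem_nthRootsFinset hn] at ha ⊢
      change C a ^ n = 1
      rw [← map_pow, ha, map_one]
    · rw [Finset.card_map, hζ.card_nthRootsFinset, hζ'.card_nthRootsFinset]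
  rw [hζ'.pow_sub_pow_eq_prod_sub_mul x y hn, ← himage, Finset.prod_map]
  rfl

section arc

variable {k l : ℕ} {D : Series} {n : ℕ} {c : ℂ} {t : Fin n → ℂ} {ν₀ νlast : ℕ} {ν : Fin n → ℕ}

/-- The initial form contributes the stated order exactly. The rest of `D` has weighted degree at
least `d + 1`, hence order at least `N * (d + 1)`, which is strictly larger by `hN`. -/
theorem exists_arc_eq (hk : 0 < k) (hl : 0 < l) (hD : D ≠ 0)
    (hin : initialForm k l D =
      C c * u ^ ν₀ * v ^ νlast * ∏ i, (v ^ k - C (t i) * u ^ l) ^ ν i)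
    {N : ℕ} {T ζ : ℂ} (hT : T ≠ 0) (hζ : ζ ≠ 0)
    (hN : ∑ i, ν i * (if t i = T then k * l else 0) < N)
    {ρ : PowerSeries ℂ} (hρ : ρ ^ k = PowerSeries.C T + PowerSeries.C ζ * PowerSeries.X ^ (k * l))
    (h : PowerSeries.constantCoeff (PowerSeries.X ^ (k * N) : PowerSeries ℂ) = 0)
    (h' : PowerSeries.constantCoeff (PowerSeries.X ^ (l * N) * ρ : PowerSeries ℂ) = 0) :
    ∃ w : PowerSeries ℂ, PowerSeries.constantCoeff w ≠ 0 ∧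
      arc (PowerSeries.X ^ (k * N)) (PowerSeries.X ^ (l * N) * ρ) h h' D =
      PowerSeries.X ^ (N * (ν₀ * k + νlast * l + ∑ i, ν i * (k * l)) +
        ∑ i, ν i * (if t i = T then k * l else 0)) * w := by
  set S := ∑ i, ν i * (if t i = T then k * l else 0) with hS
  set d' := ν₀ * k + νlast * l + ∑ i, ν i * (k * l) with hd'
  set d := (D.weightedOrder ![k, l]).toNat with hd
  obtain ⟨e, he, hwe⟩ := exists_coeff_initialForm (k := k) (l := l) hD
  have hc : c ≠ 0 := by
    rintro rfl
    rw [hin] at he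
    simp at he
  -- This inequality between the degree `d'` read off the factors and the weighted order `d`
  -- suffices for the comparison of orders.
  have hdd : d' ≤ d := by
    have h1 := le_weightedOrder_prod_form k l c t ν₀ νlast ν
    rw [← hin] at h1
    have h2 := h1.trans (weightedOrder_le ![k, l] he)
    rw [hwe] at h2
    exact_mod_cast h2
  obtain ⟨q, hq⟩ := X_pow_dvd_arc (k := k) (l := l) (N := N) (d := d + 1) (ρ := ρ) h h'
    (E := D - initialForm k l D) fun e he => coeff_sub_initialForm hD e (Nat.lt_succ_iff.1 he)
  obtain ⟨r, hr⟩ : ∃ r, N * (d + 1) = N * d' + S + 1 + r := by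
    refine Nat.exists_eq_add_of_le ?_
    nlinarith [Nat.mul_le_mul_left N hdd]
  have hkl : k * l ≠ 0 := (Nat.mul_pos hk hl).ne'
  have hρ0 : PowerSeries.constantCoeff ρ ≠ 0 := by
    intro h0
    have := congrArg PowerSeries.constantCoeff hρ
    simp [h0, hkl, hk.ne'] at this
    exact hT this.symm
  -- On the arc, `v ^ k - t i * u ^ l` is `X ^ (N * k * l) * (ρ ^ k - t i)`. The last factor is a
  -- unit unless `t i = T`, when it equals `ζ * X ^ (k * l)`.
  have hfac : ∀ i, ∃ w : PowerSeries ℂ, PowerSeries.constantCoeff w ≠ 0 ∧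
      ρ ^ k - PowerSeries.C (t i) = PowerSeries.X ^ (if t i = T then k * l else 0) * w := by
    intro i
    split_ifs with hi
    · exact ⟨PowerSeries.C ζ, by simpa, by rw [hρ, hi]; ring⟩
    · refine ⟨ρ ^ k - PowerSeries.C (t i), ?_, by simp⟩
      rw [hρ]
      simpa [hkl, sub_eq_zero, eq_comm] using hi
  choose w hw0 hw using hfac
  have hform : arc (PowerSeries.X ^ (k * N)) (PowerSeries.X ^ (l * N) * ρ) h h' (initialForm k l D) =
      PowerSeries.X ^ (N * d' + S) *
        (PowerSeries.C c * ρ ^ νlast * ∏ i, w i ^ ν i) := by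
    have hterm : ∀ i, arc (PowerSeries.X ^ (k * N)) (PowerSeries.X ^ (l * N) * ρ) h h' (v ^ k - C (t i) * u ^ l) =
        (PowerSeries.X ^ (N * (k * l) + (if t i = T then k * l else 0)) * w i) := by
      intro i
      rw [map_sub, map_mul, map_pow, map_pow, arc_u, arc_v, arc_C, pow_add,
        mul_assoc, ← hw]
      ring
    rw [hin, map_mul, map_mul, map_mul, map_prod, map_pow, map_pow, arc_u, arc_v,
      arc_C]
    simp only [map_pow, hterm]
    have hprod : (∏ i, (PowerSeries.X ^ (N * (k * l) + (if t i = T then k * l else 0)) * w i) ^ ν i :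
        PowerSeries ℂ) = PowerSeries.X ^ (N * ∑ i, ν i * (k * l) + S) * ∏ i, w i ^ ν i := by
      rw [hS, Finset.mul_sum, ← Finset.sum_add_distrib, ← Finset.prod_pow_eq_pow_sum,
        ← Finset.prod_mul_distrib]
      refine Finset.prod_congr rfl fun i _ => ?_
      ring
    rw [hprod, hd']
    ring
  refine ⟨PowerSeries.C c * ρ ^ νlast * ∏ i, w i ^ ν i + PowerSeries.X * (PowerSeries.X ^ r * q),
    ?_, ?_⟩
  · simp [hc, hρ0, Finset.prod_eq_zero_iff, hw0]
  · have hsum := congrArg₂ (· + ·) hform hq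
    simp only [map_sub, add_sub_cancel] at hsum
    rw [hr] at hsum
    refine hsum.trans ?_
    ring

/-! ### Branches of the test curve -/

theorem restrict_ramify (m : ℕ) (hm : m ≠ 0) {p : PowerSeries ℂ}
    (hp : PowerSeries.constantCoeff p = 0)
    (h : PowerSeries.constantCoeff (PowerSeries.X ^ m : PowerSeries ℂ) = 0) (F : Series) :
    restrict p hp (ramify m hm F) =
      arc (PowerSeries.X ^ m) p h hp F := by
  exact arc_evalPair _ _ _ _ _ _ (by rw [map_pow, arc_u]) (restrict_v hp) F

/-- The base change makes `u ^ (l * (N + 1))` an `N`-th power, so the difference of `N`-th powers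
factors over `ζ`. Each factor is then a difference of `k`-th powers and factors over `η`. -/
theorem ramify_testPolynomial (hk : 0 < k) {N : ℕ} (hN : 0 < N) (hm : k * N ≠ 0) (T : ℂ)
    (ρ : ℂ → PowerSeries ℂ)
    (hρ : ∀ ζ, ρ ζ ^ k = PowerSeries.C T + PowerSeries.C ζ * PowerSeries.X ^ (k * l)) :
    ramify (k * N) hm (testPolynomial k l N T) =
      ∏ x ∈ Polynomial.nthRootsFinset N (1 : ℂ) ×ˢ Polynomial.nthRootsFinset k (1 : ℂ),
        (v - embed (PowerSeries.X ^ (l * N) * (PowerSeries.C x.2 * ρ x.1))) := by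
  have hC : ∀ a, embed (PowerSeries.C a) = C a := fun a => embed.commutes a
  have h1 : ramify (k * N) hm (testPolynomial k l N T) =
      (v ^ k - C T * u ^ (k * N * l)) ^ N - (u ^ (k * l * (N + 1))) ^ N := by
    simp only [testPolynomial, ramify, map_sub, map_pow, map_mul, evalPair_u, evalPair_v,
      evalPair_C]
    ring
  rw [h1, pow_sub_pow_eq_prod_nthRoots N hN, Finset.prod_product]
  refine Finset.prod_congr rfl fun ζ _ => ?_
  have h2 : v ^ k - C T * u ^ (k * N * l) - C ζ * u ^ (k * l * (N + 1)) =
      v ^ k - (u ^ (l * N) * embed (ρ ζ)) ^ k := by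
    have := congrArg embed (hρ ζ)
    rw [map_pow, map_add, map_mul, map_pow, hC, hC, embed_X] at this
    rw [mul_pow, this]
    ring
  rw [h2, pow_sub_pow_eq_prod_nthRoots k hk]
  refine Finset.prod_congr rfl fun η _ => ?_
  rw [map_mul, map_mul, map_pow, hC, embed_X]
  ring

/-- The intersection multiplicity of `D` with the test curve of parameter `T`. -/
theorem intersectionMultiplicity_testPolynomial (hk : 0 < k) (hl : 0 < l) (hD : D ≠ 0)
    (hin : initialForm k l D =
      C c * u ^ ν₀ * v ^ νlast * ∏ i, (v ^ k - C (t i) * u ^ l) ^ ν i)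
    {N : ℕ} {T : ℂ} (hT : T ≠ 0) (hN : ∑ i, ν i * (if t i = T then k * l else 0) < N) :
    intersectionMultiplicity D (testPolynomial k l N T) =
      (N * (ν₀ * k + νlast * l + ∑ i, ν i * (k * l)) +
        ∑ i, ν i * (if t i = T then k * l else 0) : ℕ) := by
  have hN0 : 0 < N := Nat.zero_lt_of_lt hN
  have hm : k * N ≠ 0 := (Nat.mul_pos hk hN0).ne'
  choose ρ hρ using fun ζ : ℂ => exists_pow_eq_C_add k hk.ne' T hT
    (PowerSeries.C ζ * PowerSeries.X ^ (k * l)) (by simp [hk.ne', hl.ne'])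
  have h : PowerSeries.constantCoeff (PowerSeries.X ^ (k * N) : PowerSeries ℂ) = 0 := by
    simp [hk.ne', hN0.ne']
  have hmul := intersectionMultiplicity_ramify (k * N) hm D (testPolynomial k l N T)
  rw [ramify_testPolynomial hk hN0 hm T ρ hρ, intersectionMultiplicity_prod _ _
    (fun x : ℂ × ℂ => PowerSeries.X ^ (l * N) * (PowerSeries.C x.2 * ρ x.1))
    (by simp [hl.ne', hN0.ne'])
    (N * (ν₀ * k + νlast * l + ∑ i, ν i * (k * l)) +
        ∑ i, ν i * (if t i = T then k * l else 0)), Finset.card_product,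
    (Complex.isPrimitiveRoot_exp N hN0.ne').card_nthRootsFinset,
    (Complex.isPrimitiveRoot_exp k hk.ne').card_nthRootsFinset, mul_comm N k] at hmul
  -- Cancelling `k * N` in `ℕ∞` requires excluding `⊤`. The finite total over the branches does so.
  · generalize intersectionMultiplicity D (testPolynomial k l N T) = x at hmul ⊢
    cases x with
    | top =>
      rw [ENat.mul_top (Nat.cast_ne_zero.2 hm)] at hmul
      exact absurd hmul (ENat.natCast_ne_top _)
    | coe x =>
      have := Nat.eq_of_mul_eq_mul_left (Nat.pos_of_ne_zero hm) (ENat.natCast_inj.1 hmul)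
      rw [this]
  · rintro ⟨ζ, η⟩ hx
    rw [Finset.mem_product, Polynomial.mem_nthRootsFinset hN0,
      Polynomial.mem_nthRootsFinset hk] at hx
    obtain ⟨hζ, hη⟩ := hx
    have hζ0 : ζ ≠ 0 := by
      rintro rfl
      simp [hN0.ne'] at hζ
    -- As `η ^ k = 1`, the series `η * ρ ζ` is again a `k`-th root of `T + ζ * X ^ (k * l)`.
    obtain ⟨w, hw, hw'⟩ := exists_arc_eq hk hl hD hin hT hζ0 hN (ρ := PowerSeries.C η * ρ ζ)
      (by rw [mul_pow, ← map_pow, hη, map_one, one_mul, hρ]) h (by simp [hl.ne', hN0.ne'])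
    exact ⟨w, hw, (restrict_ramify _ hm _ h D).trans hw'⟩

end arc

end PlaneCurve

end

theorem mainTheorem8 (k l : ℕ) (hk : 0 < k) (hl : 0 < l) (hkl : Nat.Coprime k l)
    (D : PlaneCurve.Series) (hD : D ≠ 0)
    (n : ℕ) (c : ℂ) (t : Fin n → ℂ) (ν₀ νlast : ℕ) (ν : Fin n → ℕ)
    (ht : ∀ i, t i ≠ 0) (ht_inj : Function.Injective t)
    (hin : PlaneCurve.initialForm k l D =
      MvPowerSeries.C c * PlaneCurve.u ^ ν₀ * PlaneCurve.v ^ νlast *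
        ∏ i, (PlaneCurve.v ^ k - MvPowerSeries.C (t i) * PlaneCurve.u ^ l) ^ ν i) :
    ∃ N₀ : ℕ, ∀ N : ℕ, N₀ ≤ N → ∀ s : ℂ, s ≠ 0 → (∀ i, s ≠ t i) → ∀ j : Fin n,
      ∃ a b : ℕ,
        PlaneCurve.intersectionMultiplicity D (PlaneCurve.testPolynomial k l N (t j)) = a ∧
        PlaneCurve.intersectionMultiplicity D (PlaneCurve.testPolynomial k l N s) = b ∧
        ((ν j * k * l : ℕ) : ℤ) = (a : ℤ) - (b : ℤ) := by
  -- The sum bounds the extra order for every parameter at once, so `N₀` does not depend on `s` or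
  -- `j`.
  refine ⟨∑ i, ν i * (k * l) + 1, fun N hN s hs hst j => ?_⟩
  have hlt : ∀ T : ℂ, ∑ i, ν i * (if t i = T then k * l else 0) < N := by
    intro T
    refine lt_of_le_of_lt (Finset.sum_le_sum fun i _ => Nat.mul_le_mul_left _ ?_) hN
    split_ifs
    · exact le_rfl
    · exact Nat.zero_le _
  refine ⟨_, _, PlaneCurve.intersectionMultiplicity_testPolynomial hk hl hD hin (ht j) (hlt _),
    PlaneCurve.intersectionMultiplicity_testPolynomial hk hl hD hin hs (hlt _), ?_⟩
  have hs0 : ∑ i, ν i * (if t i = s then k * l else 0) = 0 :=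
    Finset.sum_eq_zero fun i _ => by rw [if_neg (hst i).symm, mul_zero]
  have hj : ∑ i, ν i * (if t i = t j then k * l else 0) = ν j * (k * l) := by
    simp [ht_inj.eq_iff]
  rw [hs0, hj]
  push_cast
  ring
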